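/- Let $\Gamma\subset O(4)$ be a finite group and let $f:\mathbb{R}^4\to\mathbb{R}^4$ be a $C^1$ vector field that is $\Gamma$-equivariant, i.e. $f(\gamma y)=\gamma f(y)$ for all $\gamma\in\Gamma$, $y\in\mathbb{R}^4$. A heteroclinic cycle $X$ of $\dot y=f(y)$ consists of equilibria (nodes) $\xi_1,\dots,\xi_m$, not all in the same $\Gamma$-orbit, together with, for each $i$ (indices modulo $m$), a non-constant trajectory $[\xi_i\to\xi_{i+1}]$ that tends to $\xi_i$ as $t\to-\infty$ and to $\xi_{i+1}$ as $t\to+\infty$. For a subgroup $\Sigma$ write $\mathrm{Fix}(\Sigma)=\{x\in\mathbb{R}^4:\sigma x=x \text{ for all }\sigma\in\Sigma\}$. The cycle is simple if $X\subset\mathbb{R}^4\setminus\{0\}$ and there are isotropy subgroups $\Sigma_i$ of $\Gamma$ such that, with $P_i=\mathrm{Fix}(\Sigma_i)$ and $L_i=P_{i-1}\cap P_i$, for every $i$: - $\dim P_i=2$; - $[\xi_i\to\xi_{i+1}]\subset P_i$, and in $P_i$ the equilibrium $\xi_i$ is a hyperbolic saddle and $\xi_{i+1}$ is a hyperbolic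 sink; - the group orbit $\Gamma X$ meets each connected component of $L_i\setminus\{0\}$ in at most one point; - $\mathrm{d}f(\xi_i)$ has no multiple eigenvalue. A simple network is a finite union $N$ of simple cycles that is connected and such that $\Gamma N$ meets each connected component of $L\setminus\{0\}$ in at most one point, for every $L$ among the spaces $L_i$ of its cycles. It satisfies Assumption A if (i) every cycle of the network has an elementary building block, i.e. a run of $k\ge1$ consecutive connections $[\xi_i\to\cdots\to\xi_{i+k}]$ with $\xi_{i+k}=\xi_i$ such that no two of $\xi_i,\dots,\xi_{i+k-1}$ lie in the same $\Gamma$-orbit; and (ii) every node of the network lies on a coordinate axis of $\mathbb{R}^4$. Then any two cycles of a simple network in $\mathbb{R}^4$ satisfying Assumption A have at least one connecting trajectory in common, up to symmetry: there are a connecting trajectory $\kappa$ of the first cycle, a connecting trajectory $\kappa'$ of the second, and $\gamma\in\Gamma$ with $\gamma\kappa=\kappa'$. -/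

import Mathlib

open Set Filter Topology

/-- Euclidean `ℝ⁴`. -/
abbrev E4 : Type := EuclideanSpace ℝ (Fin 4)

/-- The orthogonal group `O(4)`. -/
abbrev O4 : Type := E4 ≃ₗᵢ[ℝ] E4

/-- `f (γ y) = γ (f y)` for all `γ ∈ Γ` and all `y`. -/
def IsEquivariant (Γ : Subgroup O4) (f : E4 → E4) : Prop :=
  ∀ γ ∈ Γ, ∀ y : E4, f (γ y) = γ (f y)

/-- `x` belongs to the group orbit `Γ y`. -/
def InOrbit (Γ : Subgroup O4) (x y : E4) : Prop :=
  ∃ γ ∈ Γ, x = γ y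

/-- The union of all images `γ S`, `γ ∈ Γ`. -/
def orbitSet (Γ : Subgroup O4) (S : Set E4) : Set E4 :=
  {x | ∃ γ ∈ Γ, ∃ s ∈ S, x = γ s}

/-- `S` is an isotropy subgroup of `Γ`: the group of all elements of `Γ` that fix some point `x`. -/
def IsIsotropySubgroup (Γ S : Subgroup O4) : Prop :=
  ∃ x : E4, ∀ γ : O4, γ ∈ S ↔ γ ∈ Γ ∧ γ x = x

/-- The fixed-point space `Fix(S)`. -/
def fixedSpace (S : Subgroup O4) : Submodule ℝ E4 where
  carrier := {x | ∀ γ ∈ S, γ x = x}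
  add_mem' := by
    intro a b ha hb γ hγ
    rw [map_add, ha γ hγ, hb γ hγ]
  zero_mem' := by
    intro γ _
    exact map_zero γ
  smul_mem' := by
    intro c x hx γ hγ
    rw [map_smul, hx γ hγ]

/-- `μ` is a (complex) eigenvalue of the restriction of `A` to the `A`-invariant subspace `P`:
there is a non-zero eigenvector `u + i v` of `A` in the complexification of `P`. -/
def IsEigenvalueOn (A : E4 →L[ℝ] E4) (P : Submodule ℝ E4) (μ : ℂ) : Prop :=
  ∃ u ∈ P, ∃ v ∈ P, (u ≠ 0 ∨ v ≠ 0) ∧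
    A u = μ.re • u - μ.im • v ∧ A v = μ.im • u + μ.re • v

/-- The equilibrium `ξ` is a (hyperbolic) sink for the flow of `f` restricted to the invariant
subspace `P`. -/
def IsSinkIn (f : E4 → E4) (P : Submodule ℝ E4) (ξ : E4) : Prop :=
  ∀ μ : ℂ, IsEigenvalueOn (fderiv ℝ f ξ) P μ → μ.re < 0

/-- The equilibrium `ξ` is a (hyperbolic) saddle for the flow of `f` restricted to the invariant
subspace `P`. -/
def IsSaddleIn (f : E4 → E4) (P : Submodule ℝ E4) (ξ : E4) : Prop :=
  (∀ μ : ℂ, IsEigenvalueOn (fderiv ℝ f ξ) P μ → μ.re ≠ 0) ∧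
  (∃ μ : ℂ, IsEigenvalueOn (fderiv ℝ f ξ) P μ ∧ 0 < μ.re) ∧
  (∃ μ : ℂ, IsEigenvalueOn (fderiv ℝ f ξ) P μ ∧ μ.re < 0)

/-- `S` meets each connected component of `L \ {0}` in at most one point. -/
def MeetsComponentsAtMostOnce (S : Set E4) (L : Submodule ℝ E4) : Prop :=
  ∀ x ∈ (L : Set E4) \ {0}, (connectedComponentIn ((L : Set E4) \ {0}) x ∩ S).Subsingleton

/-- A heteroclinic cycle of `y' = f y`: equilibria `ξ_i` and non-constant trajectories
`[ξ_i → ξ_{i+1}]`, indexed cyclically, such that the equilibria do not all lie in one `Γ`-orbit. -/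
structure HeteroclinicCycle (Γ : Subgroup O4) (f : E4 → E4) where
  len : ℕ
  len_pos : 0 < len
  node : ZMod len → E4
  traj : ZMod len → ℝ → E4
  equilibrium : ∀ i, f (node i) = 0
  solution : ∀ i t, HasDerivAt (traj i) (f (traj i t)) t
  nonconstant : ∀ i, ∃ t, traj i t ≠ node i
  from_node : ∀ i, Tendsto (traj i) atBot (𝓝 (node i))
  to_node : ∀ i, Tendsto (traj i) atTop (𝓝 (node (i + 1)))
  not_homoclinic : ∃ i, ¬ InOrbit Γ (node i) (node 0)

namespace HeteroclinicCycle

variable {Γ : Subgroup O4} {f : E4 → E4}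

/-- The connecting trajectory `[ξ_i → ξ_{i+1}]` as a subset of `ℝ⁴`. -/
def connection (X : HeteroclinicCycle Γ f) (i : ZMod X.len) : Set E4 :=
  range (X.traj i)

/-- The union of the nodes and the connecting trajectories. -/
def carrier (X : HeteroclinicCycle Γ f) : Set E4 :=
  range X.node ∪ ⋃ i, X.connection i

/-- The `k` consecutive connections that start at `ξ_i` form a building block
`[ξ_i → ⋯ → ξ_{i+k}]` with `ξ_{i+k} = γ ξ_i`. -/
def IsBuildingBlock (X : HeteroclinicCycle Γ f) (i : ZMod X.len) (k : ℕ) (γ : O4) : Prop :=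
  1 ≤ k ∧ γ ∈ Γ ∧ X.node (i + k) = γ (X.node i) ∧
    ∀ l : ℕ, 1 ≤ l → l < k → ¬ InOrbit Γ (X.node (i + l)) (X.node i)

/-- The cycle has an elementary building block: `γ = Id`, and no two of the nodes
`ξ_i, …, ξ_{i+k-1}` lie in the same group orbit. -/
def HasElementaryBuildingBlock (X : HeteroclinicCycle Γ f) : Prop :=
  ∃ (i : ZMod X.len) (k : ℕ), X.IsBuildingBlock i k 1 ∧
    ∀ l l' : ℕ, l < k → l' < k → l ≠ l' → ¬ InOrbit Γ (X.node (i + l)) (X.node (i + l'))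

end HeteroclinicCycle

/-- A simple robust heteroclinic cycle in `ℝ⁴ \ {0}`. The cycle is understood together with its
images under `Γ` where its intersection with `L_i \ {0}` is concerned. -/
structure SimpleCycle (Γ : Subgroup O4) (f : E4 → E4) extends HeteroclinicCycle Γ f where
  /-- the isotropy subgroups `Σ_i`, with `P_i = Fix(Σ_i)` -/
  iso : ZMod len → Subgroup O4
  iso_isotropy : ∀ i, IsIsotropySubgroup Γ (iso i)
  /-- `dim P_i = 2` -/
  finrank_plane : ∀ i, Module.finrank ℝ (fixedSpace (iso i)) = 2
  /-- `[ξ_i → ξ_{i+1}]` is a saddle-sink connection in `P_i` -/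
  traj_mem : ∀ i t, traj i t ∈ fixedSpace (iso i)
  saddle : ∀ i, IsSaddleIn f (fixedSpace (iso i)) (node i)
  sink : ∀ i, IsSinkIn f (fixedSpace (iso i)) (node (i + 1))
  zero_notMem : (0 : E4) ∉ toHeteroclinicCycle.carrier
  /-- with `L_i = P_{i-1} ∩ P_i` -/
  meets_line : ∀ i, MeetsComponentsAtMostOnce (orbitSet Γ toHeteroclinicCycle.carrier)
    (fixedSpace (iso (i - 1)) ⊓ fixedSpace (iso i))
  /-- the linearization at a node has no multiple (complex) eigenvalues -/
  no_double_eigenvalue : ∀ i,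
    (LinearMap.charpoly (fderiv ℝ f (node i) : E4 →ₗ[ℝ] E4)).Separable

namespace SimpleCycle

variable {Γ : Subgroup O4} {f : E4 → E4}

/-- `P_i = Fix(Σ_i)`. -/
def plane (X : SimpleCycle Γ f) (i : ZMod X.len) : Submodule ℝ E4 :=
  fixedSpace (X.iso i)

/-- `L_i = P_{i-1} ∩ P_i`. -/
def line (X : SimpleCycle Γ f) (i : ZMod X.len) : Submodule ℝ E4 :=
  X.plane (i - 1) ⊓ X.plane i

end SimpleCycle

/-- A simple heteroclinic network: a finite connected union of simple cycles such that the network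
(with its images under `Γ`) meets each connected component of each `L \ {0}`, for `L` any of the
lines `L_i` of any of its cycles, in at most one point. -/
structure SimpleNetwork (Γ : Subgroup O4) (f : E4 → E4) where
  card : ℕ
  cycle : Fin card → SimpleCycle Γ f
  connected : IsConnected (⋃ c, (cycle c).carrier)
  meets_line : ∀ c i,
    MeetsComponentsAtMostOnce (orbitSet Γ (⋃ d, (cycle d).carrier)) ((cycle c).line i)

/-- `x` lies on one of the four coordinate axes. -/
def OnCoordinateAxis (x : E4) : Prop :=
  ∃ k : Fin 4, ∀ l : Fin 4, l ≠ k → x l = 0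

/-- Assumption A: every cycle has at least one elementary building block, and every equilibrium of
the network is on a coordinate axis. -/
def SimpleNetwork.AssumptionA {Γ : Subgroup O4} {f : E4 → E4} (N : SimpleNetwork Γ f) : Prop :=
  (∀ c, (N.cycle c).HasElementaryBuildingBlock) ∧
  (∀ c i, OnCoordinateAxis ((N.cycle c).node i))

/-- Two cycles have a connecting trajectory in common, up to the action of `Γ`. -/
def HaveCommonConnection {Γ : Subgroup O4} {f : E4 → E4} (X Y : HeteroclinicCycle Γ f) : Prop :=
  ∃ (i : ZMod X.len) (j : ZMod Y.len), ∃ γ ∈ Γ, (fun x => γ x) '' X.connection i = Y.connection j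

/-!
At a node `ξ_i` the planes `P_{i-1}` and `P_i` meet in the line `ℝ ξ_i`, and each of them is spanned
by `ξ_i` and a second eigenvector of `df(ξ_i)`, because `ξ_i` is fixed by both isotropy groups. An
element of the isotropy group of `ξ_i` that moves the second eigenvector must reverse it, the
eigenvalues being simple, and so acts on the plane as a reflection.

Suppose that two cycles share a node up to symmetry. The radial, contracting and expanding
eigenvectors of the two cycles at this node would be five eigenvectors with distinct eigenvalues if
neither the contracting nor the expanding plane were the same for both, which is impossible in `ℝ⁴`.

* In a common expanding plane, the unstable manifold of the saddle has only two branches, and the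
  reflection exchanges them. Uniqueness of a branch comes from the quadratic form of signature
  `(1, 1)` given by the reflection: two orbits that leave the saddle with the same unstable
  coordinate coincide.
* In a common contracting plane, the lines through the two preceding nodes are flow-invariant as
  fixed-point sets of reflections. Up to symmetry, the trajectories lie on the same side of the line
  through the sink, so if these two lines were different, one trajectory would have to cross the
  line through the source of the other. Hence the sources agree up to symmetry, and the first case
  applies to them.

To find the shared node, consider the rays spanned by the nodes. If every node is mapped to its
negative by `Γ`, then inequivalent nodes are orthogonal. An elementary building block then provides
three orthogonal nodes in each cycle, so that some node of the first cycle is not orthogonal to one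
of the second. If some node is not mapped to its negative, consecutive nodes are opposite on its
line, and connectedness of the network puts every node on this line.
-/

section Connections

variable {E : Type*} [NormedAddCommGroup E] [NormedSpace ℝ E] {f : E → E} {x y : ℝ → E}

theorem isIntegralCurve_eq_of_contDiff (hf : ContDiff ℝ 1 f) (hx : IsIntegralCurve x fun _ => f)
    (hy : IsIntegralCurve y fun _ => f) {t : ℝ} (h : x t = y t) : x = y :=
  isMIntegralCurve_Ioo_eq_of_contMDiff_boundaryless (I := modelWithCornersSelf ℝ E) (v := f)
    (contMDiff_vectorSpace_iff_contDiff.2 hf) (fun t => (hx t).hasFDerivAt.hasMFDerivAt)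
    (fun t => (hy t).hasFDerivAt.hasMFDerivAt) h

theorem exists_eq_comp_add_of_isIntegralCurve (hf : ContDiff ℝ 1 f)
    (hx : IsIntegralCurve x fun _ => f) (hy : IsIntegralCurve y fun _ => f) {s t : ℝ}
    (h : x s = y t) : ∃ d, y = fun τ => x (τ + d) :=
  ⟨s - t, isIntegralCurve_eq_of_contDiff hf hy (hx.comp_add (s - t)) (t := t) (by simp [h])⟩

theorem isIntegralCurve_map_of_commute {g : E ≃ₗᵢ[ℝ] E} (hg : Function.Commute f g)
    (hx : IsIntegralCurve x fun _ => f) : IsIntegralCurve (fun t => g (x t)) fun _ => f := by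
  intro t
  have h := (g : E →L[ℝ] E).hasFDerivAt.comp_hasDerivAt t (hx t)
  rwa [ContinuousLinearEquiv.coe_coe, LinearIsometryEquiv.coe_toContinuousLinearEquiv,
    ← hg (x t)] at h

theorem fderiv_apply_map_of_commute {g : E ≃ₗᵢ[ℝ] E} (hg : Function.Commute f g) (a v : E) :
    fderiv ℝ f (g a) (g v) = g (fderiv ℝ f a v) := by
  have h₁ := (g : E ≃L[ℝ] E).comp_right_fderiv (f := f) (x := a)
  have h₂ := (g : E ≃L[ℝ] E).comp_fderiv (f := f) (x := a)
  have : f ∘ (g : E ≃L[ℝ] E) = (g : E ≃L[ℝ] E) ∘ f := hg.comp_eq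
  rw [this, h₂] at h₁
  exact (DFunLike.congr_fun h₁ v).symm

/-- `x` is a non-constant solution of `y' = f y` in the subspace `P` that runs from the equilibrium
`a` to `b`. -/
structure IsConnection (f : E → E) (P : Submodule ℝ E) (a b : E) (x : ℝ → E) : Prop where
  equilibrium : f a = 0
  isIntegralCurve : IsIntegralCurve x fun _ => f
  nonconstant : ∃ t, x t ≠ a
  mem : ∀ t, x t ∈ P
  source : Tendsto x atBot (𝓝 a)
  target : Tendsto x atTop (𝓝 b)

namespace IsConnection

variable {P Q : Submodule ℝ E} {a b a' b' c : E}

theorem map (X : IsConnection f P a b x) {g : E ≃ₗᵢ[ℝ] E} (hg : Function.Commute f g) :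
    IsConnection f (P.map (g : E →ₗ[ℝ] E)) (g a) (g b) fun t => g (x t) where
  equilibrium := by rw [hg a, X.equilibrium, map_zero]
  isIntegralCurve := isIntegralCurve_map_of_commute hg X.isIntegralCurve
  nonconstant := X.nonconstant.imp fun _ => g.injective.ne
  mem t := Submodule.mem_map_of_mem (X.mem t)
  source := (g.continuous.tendsto a).comp X.source
  target := (g.continuous.tendsto b).comp X.target

theorem apply_ne_of_equilibrium (hf : ContDiff ℝ 1 f) (X : IsConnection f P a b x) (hc : f c = 0)
    (t : ℝ) : x t ≠ c := by
  intro h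
  have hconst : x = fun _ => c :=
    isIntegralCurve_eq_of_contDiff hf X.isIntegralCurve (isIntegralCurve_const fun _ => hc) h
  have hca : c = a := tendsto_nhds_unique tendsto_const_nhds (hconst ▸ X.source)
  obtain ⟨s, hs⟩ := X.nonconstant
  exact hs (hca ▸ congrFun hconst s)

theorem range_eq_of_apply_eq (hf : ContDiff ℝ 1 f) (X : IsConnection f P a b x)
    (Y : IsConnection f Q a' b' y) {s t : ℝ} (h : x s = y t) : range x = range y := by
  obtain ⟨d, rfl⟩ :=
    exists_eq_comp_add_of_isIntegralCurve hf X.isIntegralCurve Y.isIntegralCurve h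
  exact ((Equiv.addRight d).surjective.range_comp x).symm

theorem source_eq_of_apply_eq (hf : ContDiff ℝ 1 f) (X : IsConnection f P a b x)
    (Y : IsConnection f Q a' b' y) {s t : ℝ} (h : x s = y t) : a = a' := by
  obtain ⟨d, rfl⟩ :=
    exists_eq_comp_add_of_isIntegralCurve hf X.isIntegralCurve Y.isIntegralCurve h
  exact tendsto_nhds_unique (X.source.comp (tendsto_atBot_add_const_right _ d tendsto_id)) Y.source

end IsConnection

/-- `T` is the image of `S` under an element of the group `Γ`. -/
def IsCongruentUnder (Γ : Subgroup (E ≃ₗᵢ[ℝ] E)) (S T : Set E) : Prop :=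
  ∃ γ ∈ Γ, γ '' S = T

namespace IsCongruentUnder

variable {Γ : Subgroup (E ≃ₗᵢ[ℝ] E)} {S T U : Set E}

theorem symm (h : IsCongruentUnder Γ S T) : IsCongruentUnder Γ T S := by
  obtain ⟨γ, hγ, rfl⟩ := h
  exact ⟨γ⁻¹, Γ.inv_mem hγ, γ.toEquiv.symm_image_image S⟩

theorem trans (h : IsCongruentUnder Γ S T) (h' : IsCongruentUnder Γ T U) :
    IsCongruentUnder Γ S U := by
  obtain ⟨γ, hγ, rfl⟩ := h
  obtain ⟨δ, hδ, rfl⟩ := h'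
  exact ⟨δ * γ, Γ.mul_mem hδ hγ, by rw [image_image]; rfl⟩

end IsCongruentUnder

theorem isCongruentUnder_range_comp {Γ : Subgroup (E ≃ₗᵢ[ℝ] E)} {γ : E ≃ₗᵢ[ℝ] E} (hγ : γ ∈ Γ)
    (x : ℝ → E) : IsCongruentUnder Γ (range x) (range fun t => γ (x t)) :=
  ⟨γ, hγ, (range_comp γ x).symm⟩

end Connections

section Eigenvectors

open Module

variable {K V : Type*} [Field K] [AddCommGroup V] [Module K V] {A : End K V}

section FiniteDimensional

variable [FiniteDimensional K V]

theorem exists_eq_smul_of_apply_eq_smul (hA : A.charpoly.Separable) {μ : K} {v w : V}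
    (hv : A v = μ • v) (hv0 : v ≠ 0) (hw : A w = μ • w) : ∃ s : K, w = s • v := by
  have hdim : finrank K (A.eigenspace μ) ≤ 1 :=
    (A.finrank_eigenspace_le μ).trans (Polynomial.rootMultiplicity_le_one_of_separable hA μ)
  have hspan : K ∙ v = A.eigenspace μ :=
    Submodule.eq_of_le_of_finrank_le
      ((Submodule.span_singleton_le_iff_mem _ _).2 (End.mem_eigenspace_iff.2 hv))
      (hdim.trans_eq (finrank_span_singleton hv0).symm)
  obtain ⟨s, hs⟩ := Submodule.mem_span_singleton.1 (hspan ▸ End.mem_eigenspace_iff.2 hw)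
  exact ⟨s, hs.symm⟩

theorem isSemisimple_of_separable_charpoly (hA : A.charpoly.Separable) : A.IsSemisimple :=
  End.isSemisimple_of_squarefree_aeval_eq_zero hA.squarefree A.aeval_self_charpoly

theorem card_le_finrank_of_hasEigenvalue {s : Finset K} (hs : ∀ μ ∈ s, A.HasEigenvalue μ) :
    s.card ≤ finrank K V := by
  rw [← A.charpoly_natDegree]
  refine Polynomial.card_le_degree_of_subset_roots fun μ hμ => ?_
  rw [Polynomial.mem_roots A.charpoly_monic.ne_zero, ← End.hasEigenvalue_iff_isRoot_charpoly]
  exact hs μ hμ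

end FiniteDimensional

theorem exists_eigenvector_span_pair_eq_top (hA : A.IsSemisimple) (hV : finrank K V = 2) {u : V}
    {r : K} (hu0 : u ≠ 0) (hu : A u = r • u) :
    ∃ v, v ≠ 0 ∧ (∃ β : K, A v = β • v) ∧ Submodule.span K {u, v} = ⊤ := by
  have hinv : K ∙ u ∈ A.invtSubmodule := by
    rw [End.mem_invtSubmodule, Submodule.span_singleton_le_iff_mem, Submodule.mem_comap, hu]
    exact Submodule.smul_mem _ _ (Submodule.mem_span_singleton_self u)
  obtain ⟨q, hq, hcompl⟩ := End.isSemisimple_iff.1 hA _ hinv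
  have hq1 : finrank K q = 1 := by
    have : FiniteDimensional K V := .of_finrank_pos (by omega)
    have := Submodule.finrank_add_eq_of_isCompl hcompl
    rw [finrank_span_singleton hu0] at this
    omega
  obtain ⟨v, hvq, hv0⟩ := q.ne_bot_iff.1 (by rintro rfl; simp at hq1)
  have hqv : q = K ∙ v := eq_span_singleton_of_mem_of_finrank_eq_one hq1 hvq hv0
  obtain ⟨β, hβ⟩ := Submodule.mem_span_singleton.1 (hqv ▸ hq hvq : A v ∈ K ∙ v)
  exact ⟨v, hv0, ⟨β, hβ.symm⟩, by rw [Submodule.span_insert, ← hqv, hcompl.sup_eq_top]⟩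

theorem exists_eigenvector_span_pair_eq (hA : A.IsSemisimple) {P : Submodule K V}
    (hPA : P ∈ A.invtSubmodule) (hP : finrank K P = 2) {u : V} {r : K} (huP : u ∈ P) (hu0 : u ≠ 0)
    (hu : A u = r • u) : ∃ v, v ≠ 0 ∧ (∃ β : K, A v = β • v) ∧ Submodule.span K {u, v} = P := by
  obtain ⟨v, hv0, ⟨β, hβ⟩, hspan⟩ := exists_eigenvector_span_pair_eq_top (hA.restrict hPA) hP
    (u := ⟨u, huP⟩) (by simpa using hu0) (Subtype.ext hu)
  refine ⟨v, by simpa using hv0, ⟨β, congrArg Subtype.val hβ⟩, ?_⟩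
  simpa [Submodule.map_span, image_pair] using congrArg (Submodule.map P.subtype) hspan

end Eigenvectors

section Frames

variable {E : Type*} [NormedAddCommGroup E] [InnerProductSpace ℝ E] {Γ : Subgroup (E ≃ₗᵢ[ℝ] E)}
  {P Q : Submodule ℝ E} {ξ v w : E}

/-- The plane `P` has the basis `ξ`, `v`, and some element of `Γ` acts on `P` as the reflection in
the line through `ξ`, reversing `v`. -/
structure IsReflectionFrame (Γ : Subgroup (E ≃ₗᵢ[ℝ] E)) (P : Submodule ℝ E) (ξ v : E) : Prop where
  base_ne : ξ ≠ 0
  dir_ne : v ≠ 0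
  span_eq : Submodule.span ℝ {ξ, v} = P
  exists_reflection : ∃ g ∈ Γ, g ξ = ξ ∧ g v = -v

namespace IsReflectionFrame

theorem mem_iff (F : IsReflectionFrame Γ P ξ v) : w ∈ P ↔ ∃ s t : ℝ, s • ξ + t • v = w := by
  rw [← F.span_eq, Submodule.mem_span_pair]

theorem base_mem (F : IsReflectionFrame Γ P ξ v) : ξ ∈ P :=
  F.mem_iff.2 ⟨1, 0, by simp⟩

theorem dir_mem (F : IsReflectionFrame Γ P ξ v) : v ∈ P :=
  F.mem_iff.2 ⟨0, 1, by simp⟩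

theorem inner_eq_zero (F : IsReflectionFrame Γ P ξ v) : inner ℝ ξ v = 0 := by
  obtain ⟨g, -, hξ, hv⟩ := F.exists_reflection
  have h := g.inner_map_map ξ v
  rw [hξ, hv, inner_neg_right] at h
  linarith

theorem exists_smul_base_of_inner_dir_eq_zero (F : IsReflectionFrame Γ P ξ v) (hw : w ∈ P)
    (h : inner ℝ w v = 0) : ∃ s : ℝ, s • ξ = w := by
  obtain ⟨s, t, rfl⟩ := F.mem_iff.1 hw
  have ht : t = 0 := by simpa [inner_add_left, inner_smul_left, F.inner_eq_zero, F.dir_ne] using h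
  exact ⟨s, by simp [ht]⟩

theorem exists_smul_dir_of_inner_base_eq_zero (F : IsReflectionFrame Γ P ξ v) (hw : w ∈ P)
    (h : inner ℝ w ξ = 0) : ∃ t : ℝ, t • v = w := by
  obtain ⟨s, t, rfl⟩ := F.mem_iff.1 hw
  have hs : s = 0 := by
    simpa [inner_add_left, inner_smul_left, real_inner_comm, F.inner_eq_zero, F.base_ne] using h
  exact ⟨t, by simp [hs]⟩

theorem map (F : IsReflectionFrame Γ P ξ v) {γ : E ≃ₗᵢ[ℝ] E} (hγ : γ ∈ Γ) :
    IsReflectionFrame Γ (P.map (γ : E →ₗ[ℝ] E)) (γ ξ) (γ v) where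
  base_ne := (map_ne_zero_iff γ γ.injective).2 F.base_ne
  dir_ne := (map_ne_zero_iff γ γ.injective).2 F.dir_ne
  span_eq := by rw [← F.span_eq, Submodule.map_span, image_pair]; rfl
  exists_reflection := by
    obtain ⟨g, hg, hξ, hv⟩ := F.exists_reflection
    refine ⟨γ * g * γ⁻¹, Γ.mul_mem (Γ.mul_mem hγ hg) (Γ.inv_mem hγ), ?_, ?_⟩
    · simp [hξ]
    · simp [hv]

theorem map_plane_eq (F : IsReflectionFrame Γ P ξ v) {g : E ≃ₗᵢ[ℝ] E} (hξ : g ξ = ξ)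
    (hv : g v = -v) : P.map (g : E →ₗ[ℝ] E) = P := by
  have hξ' : (g : E →ₗ[ℝ] E) ξ = ξ := hξ
  have hv' : (g : E →ₗ[ℝ] E) v = -v := hv
  rw [← F.span_eq, Submodule.map_span, image_pair, hξ', hv', Submodule.span_insert,
    Submodule.span_insert, ← Set.neg_singleton, Submodule.span_neg]

theorem plane_eq_of_dir_eq_smul (F : IsReflectionFrame Γ P ξ v) (G : IsReflectionFrame Γ Q ξ w)
    {s : ℝ} (h : w = s • v) : P = Q := by
  have hs : IsUnit s := isUnit_iff_ne_zero.2 fun h0 => G.dir_ne (by simp [h, h0])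
  rw [← F.span_eq, ← G.span_eq, h, Submodule.span_insert, Submodule.span_insert,
    Submodule.span_singleton_smul_eq hs]

end IsReflectionFrame

/-- A reflection frame of `P` that consists of eigenvectors of `A`, with the eigenvalue `r` in the
direction of the base point `ξ` and `β` in the direction of `v`. -/
structure IsEigenframe (Γ : Subgroup (E ≃ₗᵢ[ℝ] E)) (A : E →L[ℝ] E) (P : Submodule ℝ E) (ξ v : E)
    (r β : ℝ) : Prop extends IsReflectionFrame Γ P ξ v where
  apply_base : A ξ = r • ξ
  apply_dir : A v = β • v

namespace IsEigenframe

variable {A : E →L[ℝ] E} {r β : ℝ}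

theorem map {f : E → E} (F : IsEigenframe Γ (fderiv ℝ f ξ) P ξ v r β) {γ : E ≃ₗᵢ[ℝ] E}
    (hγ : γ ∈ Γ) (hcomm : Function.Commute f γ) :
    IsEigenframe Γ (fderiv ℝ f (γ ξ)) (P.map (γ : E →ₗ[ℝ] E)) (γ ξ) (γ v) r β where
  toIsReflectionFrame := F.toIsReflectionFrame.map hγ
  apply_base := by rw [fderiv_apply_map_of_commute hcomm, F.apply_base, map_smul]
  apply_dir := by rw [fderiv_apply_map_of_commute hcomm, F.apply_dir, map_smul]

theorem base_eigenvalue_eq {r' β' : ℝ} (F : IsEigenframe Γ A P ξ v r β)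
    (G : IsEigenframe Γ A Q ξ w r' β') : r = r' :=
  smul_left_injective ℝ F.base_ne (F.apply_base.symm.trans G.apply_base)

end IsEigenframe

section Existence

variable [FiniteDimensional ℝ E] {A : E →L[ℝ] E}

theorem apply_eq_or_eq_neg_of_commute (hA : (A : E →ₗ[ℝ] E).charpoly.Separable) {β : ℝ}
    (hv0 : v ≠ 0) (hv : A v = β • v) {g : E ≃ₗᵢ[ℝ] E} (hg : A (g v) = g (A v)) :
    g v = v ∨ g v = -v := by
  obtain ⟨s, hs⟩ := exists_eq_smul_of_apply_eq_smul hA (μ := β) (w := g v) hv hv0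
    (by simp [hg, hv])
  have hs1 : |s| = 1 := by
    have h := g.norm_map v
    rwa [hs, norm_smul, Real.norm_eq_abs, mul_eq_right₀ (norm_ne_zero_iff.2 hv0)] at h
  rcases eq_or_eq_neg_of_abs_eq hs1 with rfl | rfl
  · exact .inl (by rw [hs, one_smul])
  · exact .inr (by rw [hs, neg_one_smul])

theorem exists_isEigenframe (hA : (A : E →ₗ[ℝ] E).charpoly.Separable) (hPA : ∀ w ∈ P, A w ∈ P)
    (hP : Module.finrank ℝ P = 2) (hξP : ξ ∈ P) (hξ : ξ ≠ 0)
    (hcomm : ∀ g ∈ Γ, g ξ = ξ → ∀ w, A (g w) = g (A w))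
    (hfix : ∀ w ∈ P, (∀ g ∈ Γ, g ξ = ξ → g w = w) → w ∈ ℝ ∙ ξ) :
    ∃ v r β, IsEigenframe Γ A P ξ v r β := by
  obtain ⟨r, hr⟩ := Submodule.mem_span_singleton.1 <|
    hfix (A ξ) (hPA ξ hξP) fun g hg hgξ => by rw [← hcomm g hg hgξ, hgξ]
  obtain ⟨v, hv0, ⟨β, hβ⟩, hspan⟩ := exists_eigenvector_span_pair_eq
    (isSemisimple_of_separable_charpoly hA) hPA hP hξP hξ hr.symm
  have hvξ : v ∉ ℝ ∙ ξ := by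
    intro hv
    rw [pair_comm, Submodule.span_insert_eq_span hv] at hspan
    rw [← hspan, finrank_span_singleton hξ] at hP
    exact absurd hP (by norm_num)
  obtain ⟨g, hg, hgξ, hgv⟩ : ∃ g ∈ Γ, g ξ = ξ ∧ g v ≠ v := by
    have hvP : v ∈ P := hspan ▸ Submodule.subset_span (by simp)
    by_contra! h
    exact hvξ (hfix v hvP h)
  have hneg := (apply_eq_or_eq_neg_of_commute hA hv0 hβ (hcomm g hg hgξ v)).resolve_left hgv
  exact ⟨v, r, β, ⟨hξ, hv0, hspan, g, hg, hgξ, hneg⟩, hr.symm, hβ⟩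

namespace IsEigenframe

variable {P' Q' : Submodule ℝ E} {r β : ℝ}

theorem plane_eq_of_eigenvalue_eq (hA : (A : E →ₗ[ℝ] E).charpoly.Separable) {r' : ℝ}
    (F : IsEigenframe Γ A P ξ v r β) (G : IsEigenframe Γ A Q ξ w r' β) : P = Q := by
  obtain ⟨s, hs⟩ := exists_eq_smul_of_apply_eq_smul hA F.apply_dir F.dir_ne G.apply_dir
  exact F.plane_eq_of_dir_eq_smul G.toIsReflectionFrame hs

theorem base_eigenvalue_ne (hA : (A : E →ₗ[ℝ] E).charpoly.Separable)
    (F : IsEigenframe Γ A P ξ v r β) : r ≠ β := by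
  rintro rfl
  obtain ⟨s, rfl⟩ := exists_eq_smul_of_apply_eq_smul hA F.apply_base F.base_ne F.apply_dir
  have h := F.inner_eq_zero
  rw [inner_smul_right, mul_eq_zero, inner_self_eq_zero] at h
  exact h.elim (fun hs => F.dir_ne (by rw [hs, zero_smul])) F.base_ne

theorem plane_eq_or_plane_eq (hA : (A : E →ₗ[ℝ] E).charpoly.Separable)
    (hE : Module.finrank ℝ E ≤ 4) {p q p' q' : E} {r a r₂ b r' a' r₂' b' : ℝ}
    (FP : IsEigenframe Γ A P ξ p r a) (FQ : IsEigenframe Γ A Q ξ q r₂ b)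
    (FP' : IsEigenframe Γ A P' ξ p' r' a') (FQ' : IsEigenframe Γ A Q' ξ q' r₂' b')
    (hr : r < 0) (ha : a < 0) (ha' : a' < 0) (hb : 0 < b) (hb' : 0 < b') :
    P = P' ∨ Q = Q' := by
  obtain rfl := FP.base_eigenvalue_eq FP'
  by_cases haa : a = a'
  · subst haa
    exact .inl (FP.plane_eq_of_eigenvalue_eq hA FP')
  by_cases hbb : b = b'
  · subst hbb
    exact .inr (FQ.plane_eq_of_eigenvalue_eq hA FQ')
  have hcard : ({r, a, a', b, b'} : Finset ℝ).card = 5 := by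
    have h₁ := FP.base_eigenvalue_ne hA
    have h₂ := FP'.base_eigenvalue_ne hA
    grind
  have hle := card_le_finrank_of_hasEigenvalue (A := (A : E →ₗ[ℝ] E)) (s := {r, a, a', b, b'}) <| by
    have heig {μ : ℝ} {u : E} (hu : A u = μ • u) (hu0 : u ≠ 0) :
        Module.End.HasEigenvalue (A : E →ₗ[ℝ] E) μ :=
      Module.End.hasEigenvalue_of_hasEigenvector
        (Module.End.hasEigenvector_iff.2 ⟨Module.End.mem_eigenspace_iff.2 hu, hu0⟩)
    simp only [Finset.mem_insert, Finset.mem_singleton]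
    rintro μ (rfl | rfl | rfl | rfl | rfl)
    exacts [heig FP.apply_base FP.base_ne, heig FP.apply_dir FP.dir_ne,
      heig FP'.apply_dir FP'.dir_ne, heig FQ.apply_dir FQ.dir_ne, heig FQ'.apply_dir FQ'.dir_ne]
  omega

end IsEigenframe

end Existence

end Frames

section Cone

variable {E : Type*} [NormedAddCommGroup E] [InnerProductSpace ℝ E] {Γ : Subgroup (E ≃ₗᵢ[ℝ] E)}
  {f : E → E} {A : E →L[ℝ] E} {J : E ≃ₗᵢ[ℝ] E} {P : Submodule ℝ E} {U : Set E} {a v w p q : E}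
  {x y : ℝ → E} {r β : ℝ} {c : NNReal}

theorem IsEigenframe.inner_apply_reflection_le (F : IsEigenframe Γ A P a v r β) (hw : w ∈ P) :
    inner ℝ (A w) ((ℝ ∙ v)ᗮ.reflection w) ≤ -min (-r) β * ‖w‖ ^ 2 := by
  obtain ⟨s, t, rfl⟩ := F.mem_iff.1 hw
  have hva : inner ℝ v a = 0 := by rw [real_inner_comm, F.inner_eq_zero]
  have ha : (ℝ ∙ v)ᗮ.reflection a = a :=
    (ℝ ∙ v)ᗮ.reflection_mem_subspace_eq_self
      (Submodule.mem_orthogonal_singleton_iff_inner_right.2 hva)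
  have hv : (ℝ ∙ v)ᗮ.reflection v = -v :=
    Submodule.reflection_orthogonalComplement_singleton_eq_neg v
  have hnorm : ‖s • a + t • v‖ ^ 2 = s ^ 2 * ‖a‖ ^ 2 + t ^ 2 * ‖v‖ ^ 2 := by
    rw [norm_add_sq_real, inner_smul_left, inner_smul_right, F.inner_eq_zero, norm_smul, norm_smul,
      mul_pow, mul_pow, Real.norm_eq_abs, Real.norm_eq_abs, sq_abs, sq_abs]
    simp
  have hinner : inner ℝ (A (s • a + t • v)) ((ℝ ∙ v)ᗮ.reflection (s • a + t • v)) =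
      r * (s ^ 2 * ‖a‖ ^ 2) - β * (t ^ 2 * ‖v‖ ^ 2) := by
    simp only [map_add, map_smul, F.apply_base, F.apply_dir, ha, hv, inner_add_left,
      inner_add_right, inner_smul_left, inner_smul_right, inner_neg_right, F.inner_eq_zero, hva,
      real_inner_self_eq_norm_sq, conj_trivial]
    ring
  have h₁ : min (-r) β * (s ^ 2 * ‖a‖ ^ 2) ≤ -r * (s ^ 2 * ‖a‖ ^ 2) := by
    gcongr
    exact min_le_left _ _
  have h₂ : min (-r) β * (t ^ 2 * ‖v‖ ^ 2) ≤ β * (t ^ 2 * ‖v‖ ^ 2) := by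
    gcongr
    exact min_le_right _ _
  rw [hnorm, hinner]
  linarith

theorem inner_sub_map_sub_nonpos (hfA : ApproximatesLinearOn f A U c)
    (hA : ∀ w ∈ P, inner ℝ (A w) (J w) ≤ -c * ‖w‖ ^ 2) (hp : p ∈ U) (hq : q ∈ U)
    (hpq : p - q ∈ P) : inner ℝ (f p - f q) (J (p - q)) ≤ 0 := by
  have herr : inner ℝ (f p - f q - A (p - q)) (J (p - q)) ≤ c * ‖p - q‖ ^ 2 :=
    calc
      _ ≤ ‖f p - f q - A (p - q)‖ * ‖J (p - q)‖ := real_inner_le_norm _ _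
      _ ≤ (c * ‖p - q‖) * ‖p - q‖ := by
        rw [J.norm_map]
        gcongr
        exact hfA p hp q hq
      _ = c * ‖p - q‖ ^ 2 := by ring
  rw [inner_sub_left] at herr
  linarith [hA _ hpq]

/-- The form `w ↦ ⟪w, J w⟫` decreases along the difference of the two solutions, which tends to `0`
in backward time. -/
theorem inner_sub_map_sub_nonpos_of_isIntegralCurve (hJ : J.symm = J)
    (hfA : ApproximatesLinearOn f A U c) (hA : ∀ w ∈ P, inner ℝ (A w) (J w) ≤ -c * ‖w‖ ^ 2)
    (hx : IsIntegralCurve x fun _ => f) (hy : IsIntegralCurve y fun _ => f)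
    (hxP : ∀ t, x t ∈ P) (hyP : ∀ t, y t ∈ P) (hxa : Tendsto x atBot (𝓝 a))
    (hya : Tendsto y atBot (𝓝 a)) {T : ℝ} (hxU : ∀ t ≤ T, x t ∈ U) (hyU : ∀ t ≤ T, y t ∈ U) :
    inner ℝ (x T - y T) (J (x T - y T)) ≤ 0 := by
  set D : ℝ → ℝ := fun t => inner ℝ (x t - y t) (J (x t - y t))
  have hD (t : ℝ) : HasDerivAt D (2 * inner ℝ (f (x t) - f (y t)) (J (x t - y t))) t := by
    have hw := (hx t).sub (hy t)
    have h : HasDerivAt D (inner ℝ (x t - y t) (J (f (x t) - f (y t))) +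
        inner ℝ (f (x t) - f (y t)) (J (x t - y t))) t :=
      hw.inner ℝ ((J : E →L[ℝ] E).hasFDerivAt.comp_hasDerivAt t hw)
    rwa [real_inner_comm, J.inner_map_eq_flip, hJ, ← two_mul] at h
  have hanti : AntitoneOn D (Iic T) := by
    refine antitoneOn_of_deriv_nonpos (convex_Iic T)
      (fun t _ => (hD t).continuousAt.continuousWithinAt)
      (fun t _ => (hD t).differentiableAt.differentiableWithinAt) fun t ht => ?_
    have htT : t ≤ T := mem_Iic.1 (interior_subset ht)
    rw [(hD t).deriv]
    linarith [inner_sub_map_sub_nonpos hfA hA (hxU t htT) (hyU t htT) (P.sub_mem (hxP t) (hyP t))]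
  have hlim : Tendsto D atBot (𝓝 0) := by
    have hw : Tendsto (fun t => x t - y t) atBot (𝓝 0) := by simpa using hxa.sub hya
    have h : Tendsto D atBot (𝓝 (inner ℝ 0 (J 0))) :=
      hw.inner (𝕜 := ℝ) ((J.continuous.tendsto 0).comp hw)
    rwa [inner_zero_left] at h
  refine ge_of_tendsto hlim ?_
  filter_upwards [eventually_le_atBot T] with t ht using hanti ht self_mem_Iic ht

theorem IsEigenframe.exists_forall_le_eq_of_inner_eq (F : IsEigenframe Γ A P a v r β) (hr : r < 0)
    (hβ : 0 < β) (hf : HasStrictFDerivAt f A a) (hx : IsIntegralCurve x fun _ => f)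
    (hy : IsIntegralCurve y fun _ => f) (hxP : ∀ t, x t ∈ P) (hyP : ∀ t, y t ∈ P)
    (hxa : Tendsto x atBot (𝓝 a)) (hya : Tendsto y atBot (𝓝 a)) :
    ∃ T, ∀ s ≤ T, ∀ t ≤ T, inner ℝ (x s) v = inner ℝ (y t) v → x s = y t := by
  set m : NNReal := (min (-r) β).toNNReal
  have hm : 0 < min (-r) β := lt_min (by linarith) hβ
  obtain ⟨U, hU, hfA⟩ :=
    hf.approximates_deriv_on_nhds (c := m) (.inr (Real.toNNReal_pos.2 hm))
  obtain ⟨T, hT⟩ := eventually_atBot.1 ((hxa.eventually hU).and (hya.eventually hU))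
  refine ⟨T, fun s hs t ht hst => ?_⟩
  set J := (ℝ ∙ v)ᗮ.reflection
  have hle := inner_sub_map_sub_nonpos_of_isIntegralCurve (J := J) (y := fun τ => y (τ + (t - s)))
    (T := s) Submodule.reflection_symm hfA
    (fun w hw => by simpa [m, Real.coe_toNNReal _ hm.le] using F.inner_apply_reflection_le hw)
    hx (hy.comp_add (t - s)) hxP (fun τ => hyP _) hxa
    (hya.comp (tendsto_atBot_add_const_right _ _ tendsto_id))
    (fun τ hτ => (hT τ (hτ.trans hs)).1) (fun τ hτ => (hT _ (by linarith)).2)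
  have hfix : J (x s - y t) = x s - y t :=
    (ℝ ∙ v)ᗮ.reflection_mem_subspace_eq_self
      (Submodule.mem_orthogonal_singleton_iff_inner_left.2 (by rw [inner_sub_left, hst, sub_self]))
  rw [add_sub_cancel, hfix] at hle
  exact sub_eq_zero.1 (real_inner_self_nonpos.1 hle)

section Sides

variable {b b' : E}

theorem IsEigenframe.tendsto_inner_atBot (F : IsEigenframe Γ A P a v r β)
    (X : IsConnection f P a b x) : Tendsto (fun t => inner ℝ (x t) v) atBot (𝓝 0) := by
  simpa only [F.inner_eq_zero] using X.source.inner (𝕜 := ℝ) (tendsto_const_nhds (x := v))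

theorem IsConnection.continuous_inner (X : IsConnection f P a b x) (v : E) :
    Continuous fun t => inner ℝ (x t) v :=
  X.isIntegralCurve.continuous.inner continuous_const

theorem IsEigenframe.eventually_inner_pos_or_neg (F : IsEigenframe Γ (fderiv ℝ f a) P a v r β)
    (hr : r < 0) (hβ : 0 < β) (hf : ContDiff ℝ 1 f) (X : IsConnection f P a b x) :
    (∀ᶠ t in atBot, 0 < inner ℝ (x t) v) ∨ ∀ᶠ t in atBot, inner ℝ (x t) v < 0 := by
  obtain ⟨T, hT⟩ := F.exists_forall_le_eq_of_inner_eq hr hβ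
    (hf.contDiffAt.hasStrictFDerivAt one_ne_zero) X.isIntegralCurve
    (isIntegralCurve_const fun _ => X.equilibrium) X.mem (fun _ => F.base_mem) X.source
    tendsto_const_nhds
  have hne : ∀ t ∈ Iic T, inner ℝ (x t) v ≠ 0 := fun t ht h =>
    X.apply_ne_of_equilibrium hf X.equilibrium t (hT t ht T le_rfl (by rw [h, F.inner_eq_zero]))
  by_contra! h
  obtain ⟨s, hs, hsT⟩ := (h.1.and_eventually (eventually_le_atBot T)).exists
  obtain ⟨t, ht, htT⟩ := (h.2.and_eventually (eventually_le_atBot T)).exists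
  obtain ⟨τ, hτ, h0⟩ := isPreconnected_Iic.intermediate_value hsT htT
    (X.continuous_inner v).continuousOn ⟨hs, ht⟩
  exact hne τ hτ h0

theorem IsEigenframe.range_eq_of_eventually_inner_pos
    (F : IsEigenframe Γ (fderiv ℝ f a) P a v r β) (hr : r < 0) (hβ : 0 < β) (hf : ContDiff ℝ 1 f)
    (X : IsConnection f P a b x) (Y : IsConnection f P a b' y)
    (hx : ∀ᶠ t in atBot, 0 < inner ℝ (x t) v) (hy : ∀ᶠ t in atBot, 0 < inner ℝ (y t) v) :
    range x = range y := by
  obtain ⟨T, hT⟩ := F.exists_forall_le_eq_of_inner_eq hr hβ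
    (hf.contDiffAt.hasStrictFDerivAt one_ne_zero) X.isIntegralCurve Y.isIntegralCurve X.mem Y.mem
    X.source Y.source
  obtain ⟨t, ⟨hxt, hyt⟩, htT⟩ := ((hx.and hy).and (eventually_le_atBot T)).exists
  set m := min (inner ℝ (x t) v) (inner ℝ (y t) v)
  have hm : 0 < m := lt_min hxt hyt
  have hattains {z : ℝ → E} {c : E} (Z : IsConnection f P a c z) (hmz : m ≤ inner ℝ (z t) v) :
      ∃ s ≤ T, inner ℝ (z s) v = m := by
    obtain ⟨u, hu, huT⟩ := ((F.tendsto_inner_atBot Z).eventually_le_const hm |>.and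
      (eventually_le_atBot T)).exists
    obtain ⟨s, hs, h⟩ := isPreconnected_Iic.intermediate_value huT htT
      (Z.continuous_inner v).continuousOn ⟨hu, hmz⟩
    exact ⟨s, hs, h⟩
  obtain ⟨s, hs, hxs⟩ := hattains X (min_le_left _ _)
  obtain ⟨s', hs', hys⟩ := hattains Y (min_le_right _ _)
  exact X.range_eq_of_apply_eq hf Y (hT s hs s' hs' (hxs.trans hys.symm))

theorem IsEigenframe.exists_isConnection_eventually_inner_pos
    (F : IsEigenframe Γ (fderiv ℝ f a) P a v r β) (hr : r < 0) (hβ : 0 < β) (hf : ContDiff ℝ 1 f)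
    (hΓ : ∀ γ ∈ Γ, Function.Commute f γ) (X : IsConnection f P a b x) :
    ∃ γ ∈ Γ, IsConnection f P a (γ b) (fun t => γ (x t)) ∧
      ∀ᶠ t in atBot, 0 < inner ℝ (γ (x t)) v := by
  rcases F.eventually_inner_pos_or_neg hr hβ hf X with hpos | hneg
  · exact ⟨1, Γ.one_mem, X, hpos⟩
  · obtain ⟨g, hg, hga, hgv⟩ := F.exists_reflection
    have X' := X.map (hΓ g hg)
    rw [F.map_plane_eq hga hgv, hga] at X'
    refine ⟨g, hg, X', hneg.mono fun t ht => ?_⟩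
    have h := g.inner_map_map (x t) v
    rw [hgv, inner_neg_right] at h
    linarith

theorem IsEigenframe.isCongruentUnder_range (F : IsEigenframe Γ (fderiv ℝ f a) P a v r β)
    (hr : r < 0) (hβ : 0 < β) (hf : ContDiff ℝ 1 f) (hΓ : ∀ γ ∈ Γ, Function.Commute f γ)
    (X : IsConnection f P a b x) (Y : IsConnection f P a b' y) :
    IsCongruentUnder Γ (range x) (range y) := by
  obtain ⟨γ, hγ, X', hX'⟩ := F.exists_isConnection_eventually_inner_pos hr hβ hf hΓ X
  obtain ⟨δ, hδ, Y', hY'⟩ := F.exists_isConnection_eventually_inner_pos hr hβ hf hΓ Y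
  have heq := F.range_eq_of_eventually_inner_pos hr hβ hf X' Y' hX' hY'
  exact (isCongruentUnder_range_comp hγ x).trans
    (heq ▸ (isCongruentUnder_range_comp hδ y).symm)

end Sides

end Cone

section CommonSink

variable {E : Type*} [NormedAddCommGroup E] [InnerProductSpace ℝ E] {Γ : Subgroup (E ≃ₗᵢ[ℝ] E)}
  {f : E → E} {P : Submodule ℝ E} {a b a' b' c v v' n w : E} {x y : ℝ → E} {p q p' q' r β : ℝ}

theorem sameRay_add_smul_of_cross_nonneg (hq : 0 ≤ q) (hq' : 0 ≤ q') (hp : q = 0 → p < 0)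
    (hp' : q' = 0 → p' < 0) (h : 0 ≤ q * (q * p' - p * q')) (h' : 0 ≤ q' * (q' * p - p' * q)) :
    SameRay ℝ (p • b + q • n) (p' • b + q' • n) := by
  rcases hq.eq_or_lt' with rfl | hq <;> rcases hq'.eq_or_lt' with rfl | hq'
  · simpa only [zero_smul, add_zero] using
      sameRay_smul_smul_of_mul_nonneg (v := b)
        (mul_nonneg_of_nonpos_of_nonpos (hp rfl).le (hp' rfl).le)
  · nlinarith [hp rfl, mul_pos hq' hq']
  · nlinarith [hp' rfl, mul_pos hq hq]
  · have hcross : q' * p = q * p' := by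
      linarith [nonneg_of_mul_nonneg_right h hq, nonneg_of_mul_nonneg_right h' hq']
    refine .inr (.inr ⟨q', q, hq', hq, ?_⟩)
    rw [smul_add, smul_add, smul_smul, smul_smul, smul_smul, smul_smul, hcross, mul_comm q' q]

namespace IsReflectionFrame

theorem exists_apply_eq_add_smul (F : IsReflectionFrame Γ P b n) (hw : w ∈ P) :
    ∃ g ∈ Γ, g b = b ∧ P.map (g : E →ₗ[ℝ] E) = P ∧ ∃ p q : ℝ, 0 ≤ q ∧ g w = p • b + q • n := by
  obtain ⟨p, q, rfl⟩ := F.mem_iff.1 hw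
  rcases le_total 0 q with hq | hq
  · exact ⟨1, Γ.one_mem, rfl, P.map_id, p, q, hq, rfl⟩
  · obtain ⟨g, hg, hgb, hgn⟩ := F.exists_reflection
    exact ⟨g, hg, hgb, F.map_plane_eq hgb hgn, p, -q, neg_nonneg.2 hq, by simp [hgb, hgn]⟩

theorem mul_cross_nonneg (F : IsReflectionFrame Γ P b n) (G : IsReflectionFrame Γ P a v)
    (ha : a = p • b + q • n) (ha' : a' = p' • b + q' • n)
    (h : 0 ≤ inner ℝ b v * inner ℝ a' v) : 0 ≤ q * (q * p' - p * q') := by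
  have hav := G.inner_eq_zero
  rw [ha, inner_add_left, real_inner_smul_left, real_inner_smul_left] at hav
  rw [ha', inner_add_left, real_inner_smul_left, real_inner_smul_left] at h
  rcases eq_or_ne (inner ℝ b v) 0 with hbv | hbv
  · obtain ⟨t, rfl⟩ := F.exists_smul_dir_of_inner_base_eq_zero G.dir_mem
      (by rwa [real_inner_comm])
    have ht : t ≠ 0 := fun ht => G.dir_ne (by rw [ht, zero_smul])
    have hq : q = 0 := by
      simpa [inner_smul_right, F.inner_eq_zero, ht, F.dir_ne] using hav
    simp [hq]
  · refine nonneg_of_mul_nonneg_right (a := inner ℝ b v ^ 2) ?_ (by positivity)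
    have := mul_nonneg (sq_nonneg q) h
    linear_combination this + q * q' * inner ℝ b v * hav

theorem forall_inner_eq_zero_of_exists (F : IsReflectionFrame Γ P c v) (hf : ContDiff ℝ 1 f)
    (hΓ : ∀ γ ∈ Γ, Function.Commute f γ) (X : IsConnection f P a b x) (h : ∃ t, inner ℝ (x t) v = 0)
    (t : ℝ) : inner ℝ (x t) v = 0 := by
  obtain ⟨g, hg, hgc, hgv⟩ := F.exists_reflection
  obtain ⟨s, hs⟩ := h
  obtain ⟨k, hk⟩ := F.exists_smul_base_of_inner_dir_eq_zero (X.mem s) hs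
  have hgx : (fun τ => g (x τ)) = x :=
    isIntegralCurve_eq_of_contDiff hf (isIntegralCurve_map_of_commute (hΓ g hg) X.isIntegralCurve)
      X.isIntegralCurve (t := s) (by simp only [← hk, map_smul, hgc])
  have hinner := g.inner_map_map (x t) v
  rw [congrFun hgx t, hgv, inner_neg_right] at hinner
  linarith

/-- The line through the base of a frame is invariant, so that no connection crosses it. -/
theorem inner_mul_inner_nonneg (F : IsReflectionFrame Γ P c v) (hf : ContDiff ℝ 1 f)
    (hΓ : ∀ γ ∈ Γ, Function.Commute f γ) (X : IsConnection f P a b x) :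
    0 ≤ inner ℝ b v * inner ℝ a v := by
  have hbot : Tendsto (fun t => inner ℝ (x t) v) atBot (𝓝 (inner ℝ a v)) :=
    X.source.inner tendsto_const_nhds
  have htop : Tendsto (fun t => inner ℝ (x t) v) atTop (𝓝 (inner ℝ b v)) :=
    X.target.inner tendsto_const_nhds
  by_contra! hneg
  have hzero : ∃ t, inner ℝ (x t) v = 0 := by
    have hcont := X.continuous_inner v
    rcases mul_neg_iff.1 hneg with ⟨hb, ha⟩ | ⟨hb, ha⟩
    · exact mem_range_of_exists_le_of_exists_ge hcont
        (hbot.eventually_le_const ha).exists (htop.eventually_const_le hb).exists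
    · exact mem_range_of_exists_le_of_exists_ge hcont
        (htop.eventually_le_const hb).exists (hbot.eventually_const_le ha).exists
  simp only [F.forall_inner_eq_zero_of_exists hf hΓ X hzero, tendsto_const_nhds_iff] at hbot
  rw [← hbot, mul_zero] at hneg
  exact hneg.false

end IsReflectionFrame

theorem IsEigenframe.isCongruentUnder_range_of_target_eq
    (G : IsEigenframe Γ (fderiv ℝ f a) P a v r β) (hr : r < 0) (hβ : 0 < β)
    (G' : IsReflectionFrame Γ P a' v') (F : IsReflectionFrame Γ P b n) (hf : ContDiff ℝ 1 f)
    (hΓ : ∀ γ ∈ Γ, Function.Commute f γ) (X : IsConnection f P a b x) (Y : IsConnection f P a' b y)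
    (hab : ¬ SameRay ℝ a b) (hab' : ¬ SameRay ℝ a' b)
    (haa' : ∀ γ ∈ Γ, SameRay ℝ (γ a) a' → γ a = a') : IsCongruentUnder Γ (range x) (range y) := by
  obtain ⟨γ, hγ, hγb, hγP, p, q, hq, ha⟩ := F.exists_apply_eq_add_smul G.base_mem
  obtain ⟨δ, hδ, hδb, hδP, p', q', hq', ha'⟩ := F.exists_apply_eq_add_smul G'.base_mem
  have Gγ := G.map hγ (hΓ γ hγ)
  have Gδ := G'.map hδ
  have Xγ := X.map (hΓ γ hγ)
  have Yδ := Y.map (hΓ δ hδ)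
  rw [hγP] at Gγ
  rw [hδP] at Gδ
  rw [hγP, hγb] at Xγ
  rw [hδP, hδb] at Yδ
  have hneg {g : E ≃ₗᵢ[ℝ] E} {u : E} {s t : ℝ} (hgb : g b = b) (hu : g u = s • b + t • n)
      (hub : ¬ SameRay ℝ u b) (ht : t = 0) : s < 0 := by
    by_contra! hs
    refine hub (g.injective.sameRay_map_iff.1 ?_)
    rw [hu, ht, hgb, zero_smul, add_zero]
    exact SameRay.sameRay_nonneg_smul_left b hs
  have hray : SameRay ℝ (γ a) (δ a') := by
    rw [ha, ha']
    exact sameRay_add_smul_of_cross_nonneg hq hq' (hneg hγb ha hab) (hneg hδb ha' hab')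
      (F.mul_cross_nonneg Gγ.toIsReflectionFrame ha ha'
        (Gγ.inner_mul_inner_nonneg hf hΓ Yδ))
      (F.mul_cross_nonneg Gδ ha' ha (Gδ.inner_mul_inner_nonneg hf hΓ Xγ))
  have heq : γ a = δ a' := by
    have h : (δ⁻¹ * γ) a = a' := haa' _ (Γ.mul_mem (Γ.inv_mem hδ) hγ)
      (δ.injective.sameRay_map_iff.1 (by simpa using hray))
    simpa using congrArg δ h
  rw [← heq] at Yδ
  exact (isCongruentUnder_range_comp hγ x).trans <|
    (Gγ.isCongruentUnder_range hr hβ hf hΓ Xγ Yδ).trans (isCongruentUnder_range_comp hδ y).symm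

end CommonSink

section Cycles

variable {Γ S T : Subgroup O4} {f : E4 → E4} {ξ v w x y : E4} {P L : Submodule ℝ E4}
  {A : E4 →L[ℝ] E4} {r β : ℝ}

theorem IsIsotropySubgroup.le (h : IsIsotropySubgroup Γ S) : S ≤ Γ := by
  obtain ⟨x, hx⟩ := h
  exact fun γ hγ => ((hx γ).1 hγ).1

theorem fderiv_apply_mem_fixedSpace (h : IsEquivariant Γ f) (hS : S ≤ Γ) (hξ : ξ ∈ fixedSpace S)
    (hw : w ∈ fixedSpace S) : fderiv ℝ f ξ w ∈ fixedSpace S := fun γ hγ => by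
  rw [← fderiv_apply_map_of_commute (h γ (hS hγ)), hξ γ hγ, hw γ hγ]

theorem exists_isEigenframe_fixedSpace (h : IsEquivariant Γ f) (hS : S ≤ Γ) (hT : T ≤ Γ)
    (hξ : ξ ≠ 0) (hA : (fderiv ℝ f ξ : E4 →ₗ[ℝ] E4).charpoly.Separable)
    (hdim : Module.finrank ℝ (fixedSpace S) = 2) (hL : fixedSpace S ⊓ fixedSpace T = ℝ ∙ ξ) :
    ∃ v r β, IsEigenframe Γ (fderiv ℝ f ξ) (fixedSpace S) ξ v r β := by
  obtain ⟨hξS, hξT⟩ := hL ▸ Submodule.mem_span_singleton_self ξ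
  refine exists_isEigenframe hA (fun w => fderiv_apply_mem_fixedSpace h hS hξS) hdim hξS hξ
    (fun g hg hgξ w => ?_) fun w hw hfix =>
      hL ▸ ⟨hw, fun γ hγ => hfix γ (hT hγ) (hξT γ hγ)⟩
  simpa only [hgξ] using fderiv_apply_map_of_commute (h g hg) ξ w

theorem IsSinkIn.not_isSaddleIn (h : IsSinkIn f P ξ) : ¬ IsSaddleIn f P ξ := by
  rintro ⟨-, ⟨μ, hμ, hpos⟩, -⟩
  exact (h μ hμ).not_gt hpos

theorem isEigenvalueOn_of_apply_eq_smul (hw : w ∈ P) (hw0 : w ≠ 0) (h : A w = r • w) :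
    IsEigenvalueOn A P r :=
  ⟨w, hw, 0, P.zero_mem, .inl hw0, by simp [h], by simp⟩

theorem IsEigenvalueOn.re_nonpos {μ : ℂ} (hμ : IsEigenvalueOn A P μ)
    (hA : ∀ w ∈ P, inner ℝ (A w) w ≤ 0) : μ.re ≤ 0 := by
  obtain ⟨u, hu, v, hv, hne, hAu, hAv⟩ := hμ
  have hsum : inner ℝ (A u) u + inner ℝ (A v) v = μ.re * (‖u‖ ^ 2 + ‖v‖ ^ 2) := by
    simp only [hAu, hAv, inner_sub_left, inner_add_left, real_inner_smul_left,
      real_inner_self_eq_norm_sq, real_inner_comm u v]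
    ring
  have hpos : 0 < ‖u‖ ^ 2 + ‖v‖ ^ 2 := by
    rcases hne with h | h <;> positivity
  exact nonpos_of_mul_nonpos_left (hsum ▸ add_nonpos (hA u hu) (hA v hv)) hpos

theorem IsEigenframe.inner_apply_self_nonpos (F : IsEigenframe Γ A P ξ v r β) (hr : r ≤ 0)
    (hβ : β ≤ 0) (hw : w ∈ P) : inner ℝ (A w) w ≤ 0 := by
  obtain ⟨s, t, rfl⟩ := F.mem_iff.1 hw
  have hvξ : inner ℝ v ξ = 0 := by rw [real_inner_comm, F.inner_eq_zero]
  have hinner : inner ℝ (A (s • ξ + t • v)) (s • ξ + t • v) =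
      r * (s * ‖ξ‖) ^ 2 + β * (t * ‖v‖) ^ 2 := by
    simp only [map_add, map_smul, F.apply_base, F.apply_dir, inner_add_left, inner_add_right,
      real_inner_smul_left, real_inner_smul_right, F.inner_eq_zero, hvξ,
      real_inner_self_eq_norm_sq]
    ring
  rw [hinner]
  exact add_nonpos (mul_nonpos_of_nonpos_of_nonneg hr (sq_nonneg _))
    (mul_nonpos_of_nonpos_of_nonneg hβ (sq_nonneg _))

theorem HeteroclinicCycle.isConnection_top (X : HeteroclinicCycle Γ f) (i : ZMod X.len) :
    IsConnection f ⊤ (X.node i) (X.node (i + 1)) (X.traj i) :=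
  ⟨X.equilibrium i, X.solution i, X.nonconstant i, fun _ => trivial, X.from_node i, X.to_node i⟩

namespace SimpleCycle

variable (X : SimpleCycle Γ f) (i : ZMod X.len)

theorem isConnection : IsConnection f (X.plane i) (X.node i) (X.node (i + 1)) (X.traj i) :=
  { X.isConnection_top i with mem := X.traj_mem i }

theorem isConnection_pred :
    IsConnection f (X.plane (i - 1)) (X.node (i - 1)) (X.node i) (X.traj (i - 1)) := by
  simpa using X.isConnection (i - 1)

theorem node_mem_plane : X.node i ∈ X.plane i :=
  (X.plane i).closed_of_finiteDimensional.mem_of_tendsto (X.from_node i)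
    (.of_forall (X.traj_mem i))

theorem node_succ_mem_plane : X.node (i + 1) ∈ X.plane i :=
  (X.plane i).closed_of_finiteDimensional.mem_of_tendsto (X.to_node i)
    (.of_forall (X.traj_mem i))

theorem node_mem_carrier : X.node i ∈ X.carrier :=
  .inl (mem_range_self i)

theorem node_ne_zero : X.node i ≠ 0 :=
  fun h => X.zero_notMem (h ▸ X.node_mem_carrier i)

theorem node_mem_line : X.node i ∈ X.line i :=
  ⟨by simpa using X.node_succ_mem_plane (i - 1), X.node_mem_plane i⟩

theorem node_ne_node_succ : X.node i ≠ X.node (i + 1) :=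
  fun h => (X.sink i).not_isSaddleIn (h ▸ X.saddle i)

theorem sink_pred : IsSinkIn f (X.plane (i - 1)) (X.node i) := by
  simpa [plane] using X.sink (i - 1)

theorem plane_pred_ne : X.plane (i - 1) ≠ X.plane i :=
  fun h => (X.sink_pred i).not_isSaddleIn (h ▸ X.saddle i)

theorem line_eq_span : X.line i = ℝ ∙ X.node i := by
  have hlt : X.line i < X.plane i := by
    refine inf_le_right.lt_of_ne fun h => X.plane_pred_ne i ?_
    exact (Submodule.eq_of_le_of_finrank_eq (inf_eq_right.1 h)
      ((X.finrank_plane _).trans (X.finrank_plane _).symm)).symm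
  have hrank : Module.finrank ℝ (X.line i) < 2 :=
    (Submodule.finrank_lt_finrank_of_lt hlt).trans_eq (X.finrank_plane i)
  refine (Submodule.eq_of_le_of_finrank_le ?_ ?_).symm
  · simpa only [Submodule.span_singleton_le_iff_mem] using X.node_mem_line i
  · rw [finrank_span_singleton (X.node_ne_zero i)]
    omega

theorem exists_isEigenframe_pred (h : IsEquivariant Γ f) :
    ∃ v r β, IsEigenframe Γ (fderiv ℝ f (X.node i)) (X.plane (i - 1)) (X.node i) v r β ∧
      r < 0 ∧ β < 0 := by
  obtain ⟨v, r, β, F⟩ := exists_isEigenframe_fixedSpace h (X.iso_isotropy (i - 1)).le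
    (X.iso_isotropy i).le (X.node_ne_zero i) (X.no_double_eigenvalue i) (X.finrank_plane _)
    (X.line_eq_span i)
  exact ⟨v, r, β, F,
    X.sink_pred i r (isEigenvalueOn_of_apply_eq_smul F.base_mem F.base_ne F.apply_base),
    X.sink_pred i β (isEigenvalueOn_of_apply_eq_smul F.dir_mem F.dir_ne F.apply_dir)⟩

theorem exists_isEigenframe (h : IsEquivariant Γ f) :
    ∃ v r β, IsEigenframe Γ (fderiv ℝ f (X.node i)) (X.plane i) (X.node i) v r β ∧
      r < 0 ∧ 0 < β := by
  obtain ⟨v, r, β, F⟩ := exists_isEigenframe_fixedSpace h (X.iso_isotropy i).le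
    (X.iso_isotropy (i - 1)).le (X.node_ne_zero i) (X.no_double_eigenvalue i) (X.finrank_plane _)
    ((inf_comm _ _).trans (X.line_eq_span i))
  obtain ⟨v', r', β', F', hr', -⟩ := X.exists_isEigenframe_pred i h
  obtain rfl := F.base_eigenvalue_eq F'
  refine ⟨v, r, β, F, hr', ?_⟩
  obtain ⟨-, ⟨μ, hμ, hpos⟩, -⟩ := X.saddle i
  by_contra! hβ
  exact hpos.not_ge (hμ.re_nonpos fun w => F.inner_apply_self_nonpos hr'.le hβ)

end SimpleCycle

theorem MeetsComponentsAtMostOnce.eq_of_sameRay {U : Set E4} (h : MeetsComponentsAtMostOnce U L)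
    (hxU : x ∈ U) (hyU : y ∈ U) (hyL : y ∈ L) (hx0 : x ≠ 0) (hy0 : y ≠ 0) (hxy : SameRay ℝ x y) :
    x = y := by
  have hray : {z | SameRay ℝ y z ∧ z ≠ 0} ⊆ connectedComponentIn ((L : Set E4) \ {0}) y := by
    have hconn := (isConnected_setOfPred_sameRay_and_ne_zero hy0).isPreconnected
    refine hconn.subset_connectedComponentIn ⟨.rfl, hy0⟩ fun z hz => ⟨?_, hz.2⟩
    obtain ⟨s, -, rfl⟩ := hz.1.exists_nonneg_left hy0
    exact L.smul_mem s hyL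
  exact h y ⟨hyL, hy0⟩ ⟨hray ⟨hxy.symm, hx0⟩, hxU⟩ ⟨hray ⟨.rfl, hy0⟩, hyU⟩

namespace SimpleNetwork

variable (N : SimpleNetwork Γ f) {c d : Fin N.card} {i : ZMod (N.cycle c).len}
  {j : ZMod (N.cycle d).len} {γ : O4}

theorem apply_node_eq_of_sameRay (hγ : γ ∈ Γ)
    (h : SameRay ℝ (γ ((N.cycle c).node i)) ((N.cycle d).node j)) :
    γ ((N.cycle c).node i) = (N.cycle d).node j :=
  (N.meets_line d j).eq_of_sameRay
    ⟨γ, hγ, _, mem_iUnion.2 ⟨c, (N.cycle c).node_mem_carrier i⟩, rfl⟩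
    ⟨1, Γ.one_mem, _, mem_iUnion.2 ⟨d, (N.cycle d).node_mem_carrier j⟩, rfl⟩
    ((N.cycle d).node_mem_line j)
    ((map_ne_zero_iff γ γ.injective).2 ((N.cycle c).node_ne_zero i)) ((N.cycle d).node_ne_zero j) h

theorem not_sameRay_node_succ (c : Fin N.card) (i : ZMod (N.cycle c).len) :
    ¬ SameRay ℝ ((N.cycle c).node i) ((N.cycle c).node (i + 1)) :=
  fun h => (N.cycle c).node_ne_node_succ i (N.apply_node_eq_of_sameRay Γ.one_mem h)

theorem isCongruentUnder_connection (hf : ContDiff ℝ 1 f) (h : IsEquivariant Γ f) (hγ : γ ∈ Γ)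
    (hij : γ ((N.cycle c).node i) = (N.cycle d).node j)
    (hplane : ((N.cycle c).plane i).map (γ : E4 →ₗ[ℝ] E4) = (N.cycle d).plane j) :
    IsCongruentUnder Γ ((N.cycle c).connection i) ((N.cycle d).connection j) := by
  obtain ⟨v, r, β, F, hr, hβ⟩ := (N.cycle d).exists_isEigenframe j h
  have X := ((N.cycle c).isConnection i).map (h γ hγ)
  rw [hplane, hij] at X
  exact (isCongruentUnder_range_comp hγ _).trans
    (F.isCongruentUnder_range hr hβ hf h X ((N.cycle d).isConnection j))

theorem isCongruentUnder_connection_pred (hf : ContDiff ℝ 1 f) (h : IsEquivariant Γ f)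
    (hγ : γ ∈ Γ) (hij : γ ((N.cycle c).node i) = (N.cycle d).node j)
    (hplane : ((N.cycle c).plane (i - 1)).map (γ : E4 →ₗ[ℝ] E4) = (N.cycle d).plane (j - 1)) :
    IsCongruentUnder Γ ((N.cycle c).connection (i - 1)) ((N.cycle d).connection (j - 1)) := by
  obtain ⟨v, r, β, G, hr, hβ⟩ := (N.cycle c).exists_isEigenframe (i - 1) h
  obtain ⟨v', _, _, G', -, -⟩ := (N.cycle d).exists_isEigenframe (j - 1) h
  obtain ⟨n, _, _, F, -, -⟩ := (N.cycle d).exists_isEigenframe_pred j h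
  have X := ((N.cycle c).isConnection_pred i).map (h γ hγ)
  have Gγ := G.map hγ (h γ hγ)
  have hab := N.not_sameRay_node_succ c (i - 1)
  have hab' := N.not_sameRay_node_succ d (j - 1)
  rw [sub_add_cancel] at hab hab'
  rw [← γ.injective.sameRay_map_iff, hij] at hab
  rw [hplane, hij] at X
  rw [hplane] at Gγ
  exact (isCongruentUnder_range_comp hγ _).trans <|
    Gγ.isCongruentUnder_range_of_target_eq hr hβ G'.toIsReflectionFrame F.toIsReflectionFrame hf h
      X ((N.cycle d).isConnection_pred j) hab hab'
      fun δ hδ => N.apply_node_eq_of_sameRay (Γ.mul_mem hδ hγ)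

/-- The linearization at the common node has at most four eigenvalues, so that the two cycles share
the contracting or the expanding direction there. -/
theorem haveCommonConnection_of_apply_node_eq (hf : ContDiff ℝ 1 f) (h : IsEquivariant Γ f)
    (hγ : γ ∈ Γ) (hij : γ ((N.cycle c).node i) = (N.cycle d).node j) :
    HaveCommonConnection (N.cycle c).toHeteroclinicCycle (N.cycle d).toHeteroclinicCycle := by
  obtain ⟨p, r, α, P, hr, hα⟩ := (N.cycle c).exists_isEigenframe_pred i h
  obtain ⟨q, r₂, β, Q, -, hβ⟩ := (N.cycle c).exists_isEigenframe i h
  obtain ⟨p', r', α', P', -, hα'⟩ := (N.cycle d).exists_isEigenframe_pred j h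
  obtain ⟨q', r₂', β', Q', -, hβ'⟩ := (N.cycle d).exists_isEigenframe j h
  have Pγ := P.map hγ (h γ hγ)
  have Qγ := Q.map hγ (h γ hγ)
  rw [hij] at Pγ Qγ
  rcases IsEigenframe.plane_eq_or_plane_eq ((N.cycle d).no_double_eigenvalue j)
    finrank_euclideanSpace_fin.le Pγ Qγ P' Q' hr hα hα' hβ hβ' with hpred | hsucc
  · exact ⟨i - 1, j - 1, N.isCongruentUnder_connection_pred hf h hγ hij hpred⟩
  · exact ⟨i, j, N.isCongruentUnder_connection hf h hγ hij hsucc⟩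

end SimpleNetwork

end Cycles

section Connectedness

variable {α : Type*} [TopologicalSpace α]

theorem isCompact_insert_insert_range_of_tendsto {x : ℝ → α} {a b : α} (hx : Continuous x)
    (ha : Tendsto x atBot (𝓝 a)) (hb : Tendsto x atTop (𝓝 b)) :
    IsCompact (insert a (insert b (range x))) := by
  have habs : Tendsto (fun t : ℝ => |t|) (cocompact ℝ) atTop := tendsto_norm_cocompact_atTop
  have hneg : Tendsto (fun t : ℝ => -|t|) (cocompact ℝ) atBot := tendsto_neg_atTop_atBot.comp habs
  have hrange : range x = (range fun t => x (-|t|)) ∪ range fun t => x |t| := by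
    refine Subset.antisymm ?_ (union_subset (range_comp_subset_range _ x)
      (range_comp_subset_range _ x))
    rintro _ ⟨t, rfl⟩
    rcases le_total t 0 with ht | ht
    · exact .inl ⟨t, by simp only [abs_of_nonpos ht, neg_neg]⟩
    · exact .inr ⟨t, by simp only [abs_of_nonneg ht]⟩
  rw [hrange, ← union_insert, ← insert_union]
  exact ((ha.comp hneg).isCompact_insert_range_of_cocompact (hx.comp continuous_abs.neg)).union
    ((hb.comp habs).isCompact_insert_range_of_cocompact (hx.comp continuous_abs))

theorem reflTransGen_of_isPreconnected_iUnion {ι : Type*} [Finite ι] {s : ι → Set α}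
    (hs : ∀ i, IsClosed (s i)) (hne : ∀ i, (s i).Nonempty) (h : IsPreconnected (⋃ i, s i))
    (i j : ι) : Relation.ReflTransGen (fun k l => (s k ∩ s l).Nonempty) i j := by
  set R := Relation.ReflTransGen (fun k l => (s k ∩ s l).Nonempty) i
  have hclosed (p : ι → Prop) : IsClosed (⋃ k, ⋃ (_ : p k), s k) :=
    isClosed_iUnion_of_finite fun k => isClosed_iUnion_of_finite fun _ => hs k
  have hmeets {p : ι → Prop} {k : ι} (hk : p k) : ((⋃ k, s k) ∩ ⋃ k, ⋃ (_ : p k), s k).Nonempty :=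
    (hne k).mono (subset_inter (subset_iUnion s k) (subset_iUnion₂ (s := fun k _ => s k) k hk))
  have hcover : ⋃ k, s k ⊆ (⋃ k, ⋃ (_ : R k), s k) ∪ ⋃ k, ⋃ (_ : ¬ R k), s k := by
    refine iUnion_subset fun k z hzk => ?_
    by_cases hk : R k
    · exact .inl (mem_iUnion₂.2 ⟨k, hk, hzk⟩)
    · exact .inr (mem_iUnion₂.2 ⟨k, hk, hzk⟩)
  by_contra hj
  obtain ⟨z, -, hz, hz'⟩ := isPreconnected_closed_iff.1 h _ _ (hclosed R) (hclosed fun k => ¬ R k)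
    hcover (hmeets .refl) (hmeets hj)
  obtain ⟨k, hk, hzk⟩ := mem_iUnion₂.1 hz
  obtain ⟨l, hl, hzl⟩ := mem_iUnion₂.1 hz'
  exact hl (hk.tail ⟨z, hzk, hzl⟩)

variable {Γ : Subgroup O4} {f : E4 → E4}

namespace HeteroclinicCycle

theorem isClosed_carrier (X : HeteroclinicCycle Γ f) : IsClosed X.carrier := by
  have : NeZero X.len := ⟨X.len_pos.ne'⟩
  have hcarrier : X.carrier =
      ⋃ i, insert (X.node i) (insert (X.node (i + 1)) (range (X.traj i))) := by
    refine Subset.antisymm (union_subset ?_ (iUnion_mono fun i => ?_)) (iUnion_subset fun i => ?_)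
    · exact range_subset_iff.2 fun i => mem_iUnion.2 ⟨i, mem_insert _ _⟩
    · exact (subset_insert _ _).trans (subset_insert _ _)
    · exact insert_subset (.inl ⟨i, rfl⟩) <| insert_subset (.inl ⟨i + 1, rfl⟩) <|
        (subset_iUnion X.connection i).trans subset_union_right
  rw [hcarrier]
  exact isClosed_iUnion_of_finite fun i => (isCompact_insert_insert_range_of_tendsto
    (X.isConnection_top i).isIntegralCurve.continuous (X.from_node i) (X.to_node i)).isClosed

theorem exists_node_eq_of_nonempty_inter (hf : ContDiff ℝ 1 f) {X Y : HeteroclinicCycle Γ f}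
    (h : (X.carrier ∩ Y.carrier).Nonempty) : ∃ i j, X.node i = Y.node j := by
  obtain ⟨z, hX, hY⟩ := h
  simp only [carrier, connection, mem_union, mem_range, mem_iUnion] at hX hY
  rcases hX with ⟨i, rfl⟩ | ⟨i, s, rfl⟩ <;> rcases hY with ⟨j, hj⟩ | ⟨j, t, hj⟩
  · exact ⟨i, j, hj.symm⟩
  · exact absurd hj ((Y.isConnection_top j).apply_ne_of_equilibrium hf (X.equilibrium i) t)
  · exact absurd hj.symm ((X.isConnection_top i).apply_ne_of_equilibrium hf (Y.equilibrium j) s)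
  · exact ⟨i, j, (X.isConnection_top i).source_eq_of_apply_eq hf (Y.isConnection_top j) hj.symm⟩

end HeteroclinicCycle

theorem SimpleNetwork.reflTransGen_exists_node_eq (hf : ContDiff ℝ 1 f) (N : SimpleNetwork Γ f)
    (c d : Fin N.card) :
    Relation.ReflTransGen (fun c d => ∃ i j, (N.cycle c).node i = (N.cycle d).node j) c d :=
  Relation.ReflTransGen.mono
    (fun _ _ => HeteroclinicCycle.exists_node_eq_of_nonempty_inter hf) _ _
    (reflTransGen_of_isPreconnected_iUnion (fun c => (N.cycle c).isClosed_carrier)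
      (fun c => ⟨_, (N.cycle c).node_mem_carrier 0⟩) N.connected.isPreconnected c d)

end Connectedness

section Axes

theorem sameRay_or_sameRay_neg_of_mem_span_singleton {V : Type*} [AddCommGroup V] [Module ℝ V]
    {x y z : V} (hx : x ∈ ℝ ∙ z) (hy : y ∈ ℝ ∙ z) : SameRay ℝ x y ∨ SameRay ℝ x (-y) := by
  obtain ⟨s, rfl⟩ := Submodule.mem_span_singleton.1 hx
  obtain ⟨t, rfl⟩ := Submodule.mem_span_singleton.1 hy
  rcases le_total 0 (s * t) with h | h
  · exact .inl (sameRay_smul_smul_of_mul_nonneg h)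
  · rw [← neg_smul]
    exact .inr (sameRay_smul_smul_of_mul_nonneg (by linarith))

section Reversible

variable {E : Type*} [NormedAddCommGroup E] [InnerProductSpace ℝ E] {Γ : Subgroup (E ≃ₗᵢ[ℝ] E)}
  {P : Submodule ℝ E} {ξ v w z : E}

/-- Some element of `Γ` maps `z` to `-z`, so that `Γ` identifies the two rays of the line through
`z`. -/
def IsReversible (Γ : Subgroup (E ≃ₗᵢ[ℝ] E)) (z : E) : Prop :=
  ∃ γ ∈ Γ, γ z = -z

theorem IsReversible.of_mem_span_singleton (h : IsReversible Γ z) (hw : w ∈ ℝ ∙ z) :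
    IsReversible Γ w := by
  obtain ⟨γ, hγ, hz⟩ := h
  obtain ⟨s, rfl⟩ := Submodule.mem_span_singleton.1 hw
  exact ⟨γ, hγ, by rw [map_smul, hz, smul_neg]⟩

theorem IsReflectionFrame.isReversible (F : IsReflectionFrame Γ P ξ v) (hw : w ∈ P)
    (h : inner ℝ w ξ = 0) : IsReversible Γ w := by
  obtain ⟨g, hg, -, hgv⟩ := F.exists_reflection
  exact IsReversible.of_mem_span_singleton ⟨g, hg, hgv⟩ <|
    Submodule.mem_span_singleton.2 (F.exists_smul_dir_of_inner_base_eq_zero hw h)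

theorem exists_inner_ne_zero_of_finrank_lt [FiniteDimensional ℝ E] {ι κ : Type*} [Fintype ι]
    [Fintype κ] {u : ι → E} {v : κ → E} (hu : ∀ i, u i ≠ 0) (hv : ∀ k, v k ≠ 0)
    (huu : Pairwise fun i j => inner ℝ (u i) (u j) = 0)
    (hvv : Pairwise fun k l => inner ℝ (v k) (v l) = 0)
    (hcard : Module.finrank ℝ E < Fintype.card ι + Fintype.card κ) :
    ∃ i k, inner ℝ (u i) (v k) ≠ 0 := by
  by_contra! huv
  have hli : LinearIndependent ℝ (Sum.elim u v) := by
    refine linearIndependent_of_ne_zero_of_inner_eq_zero (𝕜 := ℝ) (by simp [hu, hv]) ?_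
    rintro (i | k) (j | l) hne
    · exact huu (by simpa using hne)
    · exact huv i l
    · exact (real_inner_comm _ _).trans (huv j k)
    · exact hvv (by simpa using hne)
  rw [← Fintype.card_sum] at hcard
  exact hcard.not_ge hli.fintype_card_le_finrank

end Reversible

theorem OnCoordinateAxis.exists_mem_span_single {x : E4} (hx : OnCoordinateAxis x) :
    ∃ k, x ∈ ℝ ∙ EuclideanSpace.single k (1 : ℝ) := by
  obtain ⟨k, hk⟩ := hx
  refine ⟨k, Submodule.mem_span_singleton.2 ⟨x k, PiLp.ext fun l => ?_⟩⟩
  rcases eq_or_ne l k with rfl | hl <;> simp [*]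

theorem OnCoordinateAxis.inner_eq_zero_or_sameRay_or_sameRay_neg {x y : E4}
    (hx : OnCoordinateAxis x) (hy : OnCoordinateAxis y) :
    inner ℝ x y = 0 ∨ SameRay ℝ x y ∨ SameRay ℝ x (-y) := by
  obtain ⟨k, hk⟩ := hx.exists_mem_span_single
  obtain ⟨l, hl⟩ := hy.exists_mem_span_single
  rcases eq_or_ne k l with rfl | hkl
  · exact .inr (sameRay_or_sameRay_neg_of_mem_span_singleton hk hl)
  · obtain ⟨s, rfl⟩ := Submodule.mem_span_singleton.1 hk
    obtain ⟨t, rfl⟩ := Submodule.mem_span_singleton.1 hl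
    exact .inl <| by
      simp [inner_smul_left, inner_smul_right, EuclideanSpace.inner_single_left, hkl]

theorem forall_zmod_of_forall_add_one {n : ℕ} [NeZero n] {p : ZMod n → Prop} {i : ZMod n}
    (hi : p i) (hstep : ∀ j, p j → p (j + 1)) (j : ZMod n) : p j := by
  have hadd (k : ℕ) : p (i + k) := by
    induction k with
    | zero => simpa using hi
    | succ k ih => simpa [add_assoc] using hstep _ ih
  simpa using hadd (j - i).val

variable {Γ : Subgroup O4} {f : E4 → E4}

namespace SimpleCycle

variable {X : SimpleCycle Γ f} {i : ZMod X.len}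

theorem isReversible_node_of_inner_eq_zero (hΓ : IsEquivariant Γ f)
    (h : inner ℝ (X.node i) (X.node (i + 1)) = 0) : IsReversible Γ (X.node i) := by
  obtain ⟨v, r, β, F, -, -⟩ := X.exists_isEigenframe_pred (i + 1) hΓ
  rw [add_sub_cancel_right] at F
  exact F.isReversible (X.node_mem_plane i) h

theorem node_add_two_ne_of_inner_eq_zero (h : inner ℝ (X.node i) (X.node (i + 1)) = 0) :
    X.node (i + 2) ≠ X.node i := by
  intro heq
  have hnext := X.node_succ_mem_plane (i + 1)
  rw [add_assoc, one_add_one_eq_two, heq] at hnext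
  have hline : X.node i ∈ X.line (i + 1) := ⟨by simpa using X.node_mem_plane i, hnext⟩
  rw [X.line_eq_span, Submodule.mem_span_singleton] at hline
  obtain ⟨s, hs⟩ := hline
  have hself : inner ℝ (X.node i) (X.node i) = 0 := by
    nth_rw 2 [← hs]
    rw [inner_smul_right, h, mul_zero]
  exact X.node_ne_zero i (inner_self_eq_zero.1 hself)

end SimpleCycle

namespace SimpleNetwork

variable {N : SimpleNetwork Γ f} {c d : Fin N.card} {i : ZMod (N.cycle c).len}
  {j : ZMod (N.cycle d).len}

theorem inOrbit_of_sameRay (h : SameRay ℝ ((N.cycle c).node i) ((N.cycle d).node j)) :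
    InOrbit Γ ((N.cycle d).node j) ((N.cycle c).node i) :=
  ⟨1, Γ.one_mem, (N.apply_node_eq_of_sameRay Γ.one_mem h).symm⟩

section NotReversible

theorem sameRay_neg_node_succ_of_not_isReversible (hΓ : IsEquivariant Γ f)
    (hN : ∀ c i, OnCoordinateAxis ((N.cycle c).node i))
    (h : ¬ IsReversible Γ ((N.cycle c).node i)) :
    SameRay ℝ ((N.cycle c).node i) (-(N.cycle c).node (i + 1)) := by
  rcases (hN c i).inner_eq_zero_or_sameRay_or_sameRay_neg (hN c (i + 1)) with h₀ | h₁ | h₂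
  · exact absurd (SimpleCycle.isReversible_node_of_inner_eq_zero hΓ h₀) h
  · exact absurd h₁ (N.not_sameRay_node_succ c i)
  · exact h₂

theorem sameRay_neg_node_succ_of_mem_span_singleton (hΓ : IsEquivariant Γ f)
    (hN : ∀ c i, OnCoordinateAxis ((N.cycle c).node i)) {z : E4} (hz : ¬ IsReversible Γ z)
    (hi : (N.cycle c).node i ∈ ℝ ∙ z) :
    SameRay ℝ ((N.cycle c).node i) (-(N.cycle c).node (i + 1)) := by
  refine sameRay_neg_node_succ_of_not_isReversible hΓ hN fun hrev => hz ?_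
  refine hrev.of_mem_span_singleton ?_
  obtain ⟨s, hs⟩ := Submodule.mem_span_singleton.1 hi
  have hs0 : s ≠ 0 := fun h0 => (N.cycle c).node_ne_zero i (by rw [← hs, h0, zero_smul])
  exact Submodule.mem_span_singleton.2 ⟨s⁻¹, by rw [← hs, inv_smul_smul₀ hs0]⟩

theorem node_mem_span_singleton_of_not_isReversible (hΓ : IsEquivariant Γ f)
    (hN : ∀ c i, OnCoordinateAxis ((N.cycle c).node i)) {z : E4} (hz : ¬ IsReversible Γ z)
    (hi : (N.cycle c).node i ∈ ℝ ∙ z) (j : ZMod (N.cycle c).len) :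
    (N.cycle c).node j ∈ ℝ ∙ z := by
  have : NeZero (N.cycle c).len := ⟨(N.cycle c).len_pos.ne'⟩
  refine forall_zmod_of_forall_add_one (p := fun j => (N.cycle c).node j ∈ ℝ ∙ z) hi
    (fun j hj => ?_) j
  obtain ⟨s, -, hs⟩ := (sameRay_neg_node_succ_of_mem_span_singleton hΓ hN hz hj).exists_nonneg_left
    ((N.cycle c).node_ne_zero j)
  rw [← neg_mem_iff, ← hs]
  exact Submodule.smul_mem _ s hj

theorem forall_node_mem_span_singleton_of_not_isReversible (hf : ContDiff ℝ 1 f)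
    (hΓ : IsEquivariant Γ f) (hN : ∀ c i, OnCoordinateAxis ((N.cycle c).node i)) {z : E4}
    (hz : ¬ IsReversible Γ z) (hi : (N.cycle c).node i ∈ ℝ ∙ z) (d : Fin N.card) :
    ∀ j, (N.cycle d).node j ∈ ℝ ∙ z := by
  induction N.reflTransGen_exists_node_eq hf c d with
  | refl => exact node_mem_span_singleton_of_not_isReversible hΓ hN hz hi
  | tail _ hstep ih =>
    obtain ⟨k, l, hkl⟩ := hstep
    exact node_mem_span_singleton_of_not_isReversible hΓ hN hz (hkl ▸ ih k)

theorem exists_inOrbit_of_not_isReversible (hf : ContDiff ℝ 1 f) (hΓ : IsEquivariant Γ f)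
    (hN : ∀ c i, OnCoordinateAxis ((N.cycle c).node i)) {e : Fin N.card}
    {k : ZMod (N.cycle e).len} (hk : ¬ IsReversible Γ ((N.cycle e).node k)) (c d : Fin N.card) :
    ∃ i j, InOrbit Γ ((N.cycle d).node j) ((N.cycle c).node i) := by
  have hmem := forall_node_mem_span_singleton_of_not_isReversible hf hΓ hN hk
    (Submodule.mem_span_singleton_self _)
  rcases sameRay_or_sameRay_neg_of_mem_span_singleton (hmem c 0) (hmem d 0) with h | h
  · exact ⟨0, 0, inOrbit_of_sameRay h⟩
  · have hsucc := sameRay_neg_node_succ_of_mem_span_singleton hΓ hN hk (hmem c 0)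
    refine ⟨0 + 1, 0, inOrbit_of_sameRay ?_⟩
    exact sameRay_neg_iff.1 <| hsucc.symm.trans h fun h0 => absurd h0 ((N.cycle c).node_ne_zero 0)

end NotReversible

theorem inOrbit_of_isReversible_of_inner_ne_zero
    (hN : ∀ c i, OnCoordinateAxis ((N.cycle c).node i))
    (hrev : IsReversible Γ ((N.cycle c).node i))
    (h : inner ℝ ((N.cycle c).node i) ((N.cycle d).node j) ≠ 0) :
    InOrbit Γ ((N.cycle d).node j) ((N.cycle c).node i) := by
  rcases (hN c i).inner_eq_zero_or_sameRay_or_sameRay_neg (hN d j) with h₀ | h₁ | h₂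
  · exact absurd h₀ h
  · exact inOrbit_of_sameRay h₁
  · obtain ⟨γ, hγ, hneg⟩ := hrev
    refine ⟨γ, hγ, (N.apply_node_eq_of_sameRay hγ ?_).symm⟩
    rwa [hneg, sameRay_neg_swap]

theorem exists_pairwise_inner_eq_zero (hN : ∀ c i, OnCoordinateAxis ((N.cycle c).node i))
    (hrev : ∀ i, IsReversible Γ ((N.cycle c).node i))
    (hc : (N.cycle c).HasElementaryBuildingBlock) :
    ∃ n : Fin 3 → ZMod (N.cycle c).len,
      Pairwise fun l l' => inner ℝ ((N.cycle c).node (n l)) ((N.cycle c).node (n l')) = 0 := by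
  obtain ⟨i, k, ⟨hk1, -, hk, -⟩, hdist⟩ := hc
  have horth (l l' : ℕ) (hl : l < k) (hl' : l' < k) (hne : l ≠ l') :
      inner ℝ ((N.cycle c).node (i + l)) ((N.cycle c).node (i + l')) = 0 := by
    by_contra h
    exact hdist l' l hl' hl hne.symm
      (inOrbit_of_isReversible_of_inner_ne_zero hN (hrev _) h)
  have hk3 : 3 ≤ k := by
    by_contra! hlt
    interval_cases k
    · exact (N.cycle c).node_ne_node_succ i (by simpa using hk.symm)
    · exact SimpleCycle.node_add_two_ne_of_inner_eq_zero
        (by simpa using horth 0 1 (by norm_num) (by norm_num) (by norm_num)) hk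
  exact ⟨fun l => i + (l : ℕ), fun l l' hne =>
    horth l l' (by omega) (by omega) (Fin.val_ne_of_ne hne)⟩

theorem exists_inOrbit_of_isReversible (hA : N.AssumptionA)
    (hrev : ∀ c i, IsReversible Γ ((N.cycle c).node i)) (c d : Fin N.card) :
    ∃ i j, InOrbit Γ ((N.cycle d).node j) ((N.cycle c).node i) := by
  obtain ⟨n, hn⟩ := exists_pairwise_inner_eq_zero hA.2 (hrev c) (hA.1 c)
  obtain ⟨m, hm⟩ := exists_pairwise_inner_eq_zero hA.2 (hrev d) (hA.1 d)
  obtain ⟨l, l', h⟩ := exists_inner_ne_zero_of_finrank_lt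
    (fun l => (N.cycle c).node_ne_zero (n l)) (fun l => (N.cycle d).node_ne_zero (m l)) hn hm
    (by simp)
  exact ⟨n l, m l', inOrbit_of_isReversible_of_inner_ne_zero hA.2 (hrev c _) h⟩

end SimpleNetwork

end Axes

theorem mainTheorem2_general (Γ : Subgroup O4) (f : E4 → E4) (hf : ContDiff ℝ 1 f)
    (hequiv : IsEquivariant Γ f) (N : SimpleNetwork Γ f) (hA : N.AssumptionA)
    (c d : Fin N.card) :
    HaveCommonConnection (N.cycle c).toHeteroclinicCycle (N.cycle d).toHeteroclinicCycle := by
  obtain ⟨i, j, γ, hγ, hij⟩ :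
      ∃ i j, InOrbit Γ ((N.cycle d).node j) ((N.cycle c).node i) := by
    by_cases hrev : ∀ c i, IsReversible Γ ((N.cycle c).node i)
    · exact SimpleNetwork.exists_inOrbit_of_isReversible hA hrev c d
    · push Not at hrev
      obtain ⟨e, k, hk⟩ := hrev
      exact SimpleNetwork.exists_inOrbit_of_not_isReversible hf hequiv hA.2 hk c d
  exact N.haveCommonConnection_of_apply_node_eq hf hequiv hγ hij.symm

theorem mainTheorem2 (Γ : Subgroup O4) [Finite Γ] (f : E4 → E4) (hf : ContDiff ℝ 1 f)
    (hequiv : IsEquivariant Γ f) (N : SimpleNetwork Γ f) (hA : N.AssumptionA)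
    (c d : Fin N.card) :
    HaveCommonConnection (N.cycle c).toHeteroclinicCycle (N.cycle d).toHeteroclinicCycle :=
  mainTheorem2_general Γ f hf hequiv N hA c d
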